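/- Let $G$ be a group. A partial action of $G$ on a group $H$ is a partial map $\theta:G\times H\dashrightarrow H$, written $(x,a)\mapsto xa$, such that (a) $1a$ is defined and equal to $a$ for all $a\in H$; (b) if $xa$ is defined, then $x^{-1}(xa)$ is defined and equal to $a$; (c) if $ya$ and $x(ya)$ are defined, then $(xy)a$ is defined and equal to $x(ya)$; (d) for each $x\in G$ the set $D_x=\{xa : a\in H,\ xa\text{ is defined}\}$ is a subgroup of $H$, and the bijection $D_{x^{-1}}\to D_x$, $a\mapsto xa$, is a group isomorphism. A globalization of $\theta$ in the category ${\sf A}(G,{\sf Grp})$ of (global) actions of $G$ on groups is a group $B$ on which $G$ acts by group automorphisms, together with an injective group homomorphism $\iota:H\to B$ such that for all $x\in G$ and $a\in H$: if $xa$ is defined, then $x\,\iota(a)=\iota(xa)$; and $xa$ is defined if and only if $x\,\iota(a)\in\iota(H)$. **Corollary.** Let $\theta$ be a partial action of a group $G$ on a group $H$. Each one of the following conditions is sufficient for $\theta$ to have a globalization in ${\sf A}(G,{\sf Grp})$: (i) $H$ is locally cyclic, i.e. every finitely generated subgroup of $H$ is cyclic; (ii) $|G|=3$ and $H$ is abelian.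 -/

import Mathlib

universe u v w

/-- A partial action of a group `G` on a set `A`: a partial map `G × A ⇀ A`, written as a family
of partial maps `act x : A →. A`, where `b ∈ act x a` means that `x a` is defined and equals `b`. -/
structure PartialAction (G : Type u) (A : Type v) [Group G] where
  /-- The partial map `a ↦ x a`. -/
  act : G → A →. A
  one_act : ∀ a : A, a ∈ act 1 a
  inv_act : ∀ (x : G) (a b : A), b ∈ act x a → a ∈ act x⁻¹ b
  mul_act : ∀ (x y : G) (a b c : A), b ∈ act y a → c ∈ act x b → c ∈ act (x * y) a

namespace PartialAction

variable {G : Type u} {A : Type v} [Group G]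

/-- The domain `D_x` (the range of the partial map `a ↦ x a`, equivalently the set of those
elements on which `x⁻¹` is defined). -/
def dom (θ : PartialAction G A) (x : G) : Set A :=
  {b | ∃ a, b ∈ θ.act x a}

/-- An injective map `ι` from `A` to a set `B` with a global action of `G` is a globalization of
`θ` if it is a morphism of partial actions and `x a` is defined exactly when `x ι(a) ∈ ι(A)`. -/
structure IsGlobalization (θ : PartialAction G A) {B : Type w} [MulAction G B] (ι : A → B) :
    Prop where
  injective : Function.Injective ι
  map_act : ∀ (x : G) (a b : A), b ∈ θ.act x a → x • ι a = ι b
  defined_iff : ∀ (x : G) (a : A), (θ.act x a).Dom ↔ x • ι a ∈ Set.range ι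

end PartialAction

/-- A partial action of a group `G` on a group `H`: a partial action on the underlying set such
that every domain `D_x` is a subgroup of `H` and all group operations are respected wherever
the partial maps are defined. -/
structure GroupPartialAction (G : Type u) (H : Type v) [Group G] [Group H] extends
    PartialAction G H where
  dom_isSubgroup : ∀ x : G, ∃ S : Subgroup H, (S : Set H) = toPartialAction.dom x
  act_one : ∀ (x : G) (c : H), c ∈ act x 1 → c = 1
  act_inv : ∀ (x : G) (a a' c : H), a' ∈ act x a → c ∈ act x a⁻¹ → c = a'⁻¹
  act_mul : ∀ (x : G) (a b a' b' c : H),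
    a' ∈ act x a → b' ∈ act x b → c ∈ act x (a * b) → c = a' * b'

/-- `θ` has a globalization in the category of global actions of `G` on groups: there are a group
`B` on which `G` acts by group automorphisms and a group homomorphism `ι : H → B` which is a
globalization of the underlying partial action. (An injective homomorphism of groups
automatically reflects the graphs of the group operations.) -/
def GroupPartialAction.HasGlobalization {G : Type u} {H : Type v} [Group G] [Group H]
    (θ : GroupPartialAction G H) : Prop :=
  ∃ (B : Type (max u v)) (_ : Group B) (_ : MulDistribMulAction G B) (ι : H →* B),
    θ.toPartialAction.IsGlobalization ι

/-- A group is locally cyclic if each of its finitely generated subgroups is cyclic. -/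
def IsLocallyCyclicGroup (H : Type v) [Group H] : Prop :=
  ∀ K : Subgroup H, K.FG → IsCyclic K

/-! In both cases `H` is abelian. Take one copy `xH` of `H` for each `x` in `G`, identify copies
along the partial action, and let `G` permute the copies in their direct sum modulo these
identifications. This is a globalization as soon as no new identifications are forced, which is
`single_sub_single_mem_relations_iff`. A consequence between copies `x` and `y` uses finitely many
copies, and the other ones are removed one at a time (`mem_relations_of_mem_relations_insert`).
Removing copy `n` means that a vanishing sum in it, of terms shared with other copies, must already
be a consequence of relations among those copies. `SumsDecompose` makes this work: it rewrites the
sum so that each term, being a multiple of the total, also lies in the copy containing the total. -/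

/-! ### Decomposing sums in abelian groups. -/

/-- Every way of writing an element `x` of `A` as a sum over `S` can be replaced by one whose
terms are multiples both of the old terms and of `x`. -/
def SumsDecompose {I : Type*} (A : Type*) [AddCommGroup A] (S : Finset I) : Prop :=
  ∀ c : I → A, ∃ m : I → ℤ, ∑ i ∈ S, m i • c i = ∑ i ∈ S, c i ∧
    ∀ i ∈ S, ∃ l : ℤ, m i • c i = l • ∑ j ∈ S, c j

theorem exists_zsmul_add_zsmul_eq_add {A : Type*} [AddCommGroup A] (t : A) (β γ : ℤ) :
    ∃ m k l l' : ℤ, m • (β • t) + k • (γ • t) = β • t + γ • t ∧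
      m • (β • t) = l • (β • t + γ • t) ∧ k • (γ • t) = l' • (β • t + γ • t) := by
  by_cases h : β = 0 ∧ γ = 0
  · obtain ⟨rfl, rfl⟩ := h
    exact ⟨0, 0, 0, 0, by simp⟩
  obtain ⟨g, b, c, hbc, rfl, rfl⟩ : ∃ g b c : ℤ, IsCoprime b c ∧
      β = b * g ∧ γ = c * g := by
    have hg : 0 < Int.gcd β γ := Int.gcd_pos_iff.2 (by tauto)
    obtain ⟨b, c, hbc, h₁, h₂⟩ := Int.exists_gcd_one hg
    exact ⟨_, b, c, Int.isCoprime_iff_gcd_eq_one.2 hbc, h₁, h₂⟩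
  obtain ⟨u, v, huv⟩ := hbc
  -- With `u * b + v * c = 1`, split the total `(b + c) * g` as `u * b` times itself plus `v * c`
  -- times itself.
  refine ⟨u * (b + c), v * (b + c), u * b, v * c, ?_, ?_, ?_⟩
  · simp only [smul_smul, ← add_smul]
    congr 1
    linear_combination (b + c) * g * huv
  · simp only [smul_smul, ← add_smul]
    congr 1
    ring
  · simp only [smul_smul, ← add_smul]
    congr 1
    ring

/-- The two-term case is applied to `c j` and the rest of the sum; induction then decomposes the
rescaled rest, and being a multiple of a multiple of the total suffices. -/
theorem sumsDecompose_of_exists_zsmul {I A : Type*} [AddCommGroup A]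
    (hA : ∀ a b : A, ∃ (t : A) (m n : ℤ), a = m • t ∧ b = n • t) (S : Finset I) :
    SumsDecompose A S := by
  classical
  induction S using Finset.induction_on with
  | empty => exact fun c => ⟨0, by simp⟩
  | insert j S hj ih =>
    intro c
    obtain ⟨t, β, γ, hβ, hγ⟩ := hA (c j) (∑ i ∈ S, c i)
    obtain ⟨m, k, l, l', h₁, h₂, h₃⟩ := exists_zsmul_add_zsmul_eq_add t β γ
    rw [← hβ, ← hγ] at h₁ h₂ h₃
    obtain ⟨m', hs, hm'⟩ := ih fun i => k • c i
    rw [← Finset.smul_sum] at hs hm'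
    refine ⟨fun i => if i = j then m else m' i * k, ?_, ?_⟩
    · rw [Finset.sum_insert hj, Finset.sum_insert hj, ← h₁, ← hs]
      dsimp only
      rw [if_pos rfl]
      congr 1
      refine Finset.sum_congr rfl fun i hi => ?_
      rw [if_neg (ne_of_mem_of_not_mem hi hj), mul_smul]
    · intro i hi
      rw [Finset.sum_insert hj]
      rcases Finset.mem_insert.1 hi with rfl | hi
      · exact ⟨l, by simpa using h₂⟩
      · obtain ⟨n, hn⟩ := hm' i hi
        refine ⟨n * l', ?_⟩
        dsimp only
        rw [if_neg (ne_of_mem_of_not_mem hi hj), mul_smul, mul_smul, hn, h₃]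

theorem sumsDecompose_of_card_le_one {I A : Type*} [AddCommGroup A] {S : Finset I}
    (hS : S.card ≤ 1) : SumsDecompose A S := by
  intro c
  refine ⟨1, by simp, fun i hi => ⟨1, ?_⟩⟩
  obtain rfl : S = {i} := Finset.eq_singleton_iff_unique_mem.2
    ⟨hi, fun j hj => Finset.card_le_one.1 hS j hj i hi⟩
  simp

/-! ### Embedding an abelian amalgam in its universal group. -/

/-- An amalgam of copies of an abelian group `A`, one for each `i : I`: a pair `(a, b)` in
`rel i j` means that `a` in the `i`-th copy is identified with `b` in the `j`-th copy. -/
structure AbelianAmalgam (I A : Type*) [AddCommGroup A] where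
  /-- The identifications between the copies `i` and `j`. -/
  rel : I → I → AddSubgroup (A × A)
  rel_self_iff : ∀ (i : I) (a b : A), (a, b) ∈ rel i i ↔ a = b
  symm : ∀ (i j : I) (a b : A), (a, b) ∈ rel i j → (b, a) ∈ rel j i
  trans : ∀ (i j k : I) (a b c : A), (a, b) ∈ rel i j → (b, c) ∈ rel j k → (a, c) ∈ rel i k

namespace AbelianAmalgam

open Finsupp

variable {I A : Type*} [AddCommGroup A] (R : AbelianAmalgam I A)

/-- The subgroup of `⨁ A` generated by the identifications between copies with index in `S`. -/
noncomputable def relations (S : Set I) : AddSubgroup (I →₀ A) :=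
  AddSubgroup.closure {v | ∃ i ∈ S, ∃ j ∈ S, ∃ a b, (a, b) ∈ R.rel i j ∧
    v = single i a - single j b}

variable {R}

theorem rel_unique {i j : I} {a b c : A} (hb : (a, b) ∈ R.rel i j) (hc : (a, c) ∈ R.rel i j) :
    b = c :=
  (R.rel_self_iff j b c).1 (R.trans _ _ _ _ _ _ (R.symm _ _ _ _ hb) hc)

theorem single_sub_single_mem {S : Set I} {i j : I} (hi : i ∈ S) (hj : j ∈ S) {a b : A}
    (h : (a, b) ∈ R.rel i j) : single i a - single j b ∈ R.relations S :=
  AddSubgroup.subset_closure ⟨i, hi, j, hj, a, b, h, rfl⟩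

theorem relations_mono {S T : Set I} (h : S ⊆ T) : R.relations S ≤ R.relations T :=
  AddSubgroup.closure_mono fun _ ⟨i, hi, j, hj, a, b, hab, hv⟩ =>
    ⟨i, h hi, j, h hj, a, b, hab, hv⟩

theorem exists_finset_mem_relations [DecidableEq I] {v : I →₀ A} {U : Set I}
    (hv : v ∈ R.relations U) : ∃ S : Finset I, v ∈ R.relations S := by
  induction hv using AddSubgroup.closure_induction with
  | mem v hv =>
    obtain ⟨i, -, j, -, a, b, hab, rfl⟩ := hv
    exact ⟨{i, j}, single_sub_single_mem (by simp) (by simp) hab⟩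
  | zero => exact ⟨∅, zero_mem _⟩
  | add v w _ _ hv hw =>
    obtain ⟨S, hS⟩ := hv
    obtain ⟨T, hT⟩ := hw
    exact ⟨S ∪ T, add_mem (relations_mono (by simp) hS) (relations_mono (by simp) hT)⟩
  | neg v _ hv =>
    obtain ⟨S, hS⟩ := hv
    exact ⟨S, neg_mem hS⟩

/-- This eliminates copy `n`. Isolate an index `m`: the other `c i` add up to `-c m`, which is
shared by copies `n` and `m`. After decomposing, each `k i • c i` is a multiple of `-c m`, so it is
shared by copies `n`, `m` and `i`, and transitivity yields a relation between `m` and `i` without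
`n`. -/
theorem sum_single_mem_relations [DecidableEq I] {n : I} {S : Finset I} (hn : n ∉ S)
    (hA : ∀ (T : Finset I) (m : I), n ∉ T → m ∉ T → n ≠ m → SumsDecompose A T)
    {c d : I → A} (hcd : ∀ i ∈ S, (c i, d i) ∈ R.rel n i) (hc : ∑ i ∈ S, c i = 0) :
    ∑ i ∈ S, single i (d i) ∈ R.relations S := by
  induction S using Finset.induction_on generalizing c d with
  | empty => simp
  | insert m S hm ih =>
    rw [Finset.mem_insert, not_or] at hn
    obtain ⟨k, hk, hl⟩ := hA S m hn.2 hm hn.1 c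
    rw [Finset.sum_insert hm, add_eq_zero_iff_neg_eq] at hc
    choose! l hl using hl
    have hS : ∀ i ∈ S, (c i, d i) ∈ R.rel n i := fun i hi =>
      hcd i (Finset.mem_insert_of_mem hi)
    have hm' : (-c m, -d m) ∈ R.rel n m := neg_mem (hcd m (Finset.mem_insert_self m S))
    -- The remainders `c i - k i • c i` sum to zero over the smaller set, so induction applies to
    -- them.
    have h₁ : ∑ i ∈ S, single i (d i - k i • d i) ∈ R.relations S := by
      refine ih hn.2 (c := fun i => c i - k i • c i) (fun i hi => ?_) ?_
      · exact sub_mem (hS i hi) (zsmul_mem (hS i hi) (k i))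
      · rw [Finset.sum_sub_distrib, hk, sub_self]
    have hl' : ∀ i ∈ S, (k i • c i, l i • -d m) ∈ R.rel n m := by
      intro i hi
      rw [hl i hi, ← hc]
      exact zsmul_mem hm' (l i)
    -- Both sides are identified with the same element `-c m` of copy `n`.
    have h₂ : ∑ i ∈ S, l i • -d m = -d m := by
      refine rel_unique ?_ hm'
      rw [hc, ← hk]
      convert sum_mem hl' using 1
      ext <;> simp only [Prod.fst_sum, Prod.snd_sum]
    have h₃ : ∑ i ∈ S, (single m (l i • -d m) - single i (k i • d i)) ∈
        R.relations ↑(insert m S) := by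
      refine sum_mem fun i hi => single_sub_single_mem (by simp) (by simp [hi]) ?_
      exact R.trans _ _ _ _ _ _ (R.symm _ _ _ _ (hl' i hi)) (zsmul_mem (hS i hi) (k i))
    have h₄ := sub_mem (relations_mono (by simp) h₁) h₃
    convert h₄ using 1
    rw [Finset.sum_insert hm, Finset.sum_sub_distrib, ← single_finsetSum, h₂]
    simp only [single_sub, Finset.sum_sub_distrib, single_neg]
    abel

/-- Since each `rel n i` is a subgroup, all generators joining `n` to `i` merge into a single one.
-/
theorem exists_sub_sum_mem_relations [DecidableEq I] {n : I} {S : Finset I} {v : I →₀ A}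
    (hv : v ∈ R.relations ↑(insert n S)) :
    ∃ c d : I → A, (∀ i ∈ S, (c i, d i) ∈ R.rel n i) ∧
      v - ∑ i ∈ S, (single n (c i) - single i (d i)) ∈ R.relations S := by
  have key : ∀ i ∈ S, ∀ a b, (a, b) ∈ R.rel n i → ∃ c d : I → A,
      (∀ i ∈ S, (c i, d i) ∈ R.rel n i) ∧
      ∑ i ∈ S, (single n (c i) - single i (d i)) = single n a - single i b := by
    intro i hi a b hab
    refine ⟨Pi.single i a, Pi.single i b, fun j _ => ?_, ?_⟩
    · by_cases h : j = i
      · subst h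
        simpa using hab
      · rw [Pi.single_eq_of_ne h, Pi.single_eq_of_ne h]
        exact zero_mem (R.rel n j)
    · rw [Finset.sum_eq_single i (fun j _ h => by simp [h]) (by simp [hi])]
      simp
  induction hv using AddSubgroup.closure_induction with
  | mem v hv =>
    obtain ⟨i, hi, j, hj, a, b, hab, rfl⟩ := hv
    simp only [Finset.coe_insert, Set.mem_insert_iff, Finset.mem_coe] at hi hj
    rcases hi with rfl | hi <;> rcases hj with rfl | hj
    · rw [R.rel_self_iff] at hab
      exact ⟨0, 0, fun k _ => zero_mem (R.rel _ k), by simp [hab]⟩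
    · obtain ⟨c, d, h, hs⟩ := key j hj a b hab
      exact ⟨c, d, h, by simp [hs]⟩
    · obtain ⟨c, d, h, hs⟩ := key i hi b a (R.symm _ _ _ _ hab)
      refine ⟨-c, -d, fun k hk => neg_mem (h k hk), ?_⟩
      have : ∑ k ∈ S, (single j ((-c) k) - single k ((-d) k)) = single i a - single j b := by
        rw [← neg_sub, ← hs, ← Finset.sum_neg_distrib]
        refine Finset.sum_congr rfl fun k _ => ?_
        simp only [Pi.neg_apply, single_neg]
        abel
      rw [this, sub_self]
      exact zero_mem _
    · exact ⟨0, 0, fun k _ => zero_mem (R.rel _ k), by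
        simpa using single_sub_single_mem (by simpa using hi) (by simpa using hj) hab⟩
  | zero => exact ⟨0, 0, fun k _ => zero_mem (R.rel _ k), by simp⟩
  | add v w _ _ hv hw =>
    obtain ⟨c, d, h, hv⟩ := hv
    obtain ⟨c', d', h', hw⟩ := hw
    refine ⟨c + c', d + d', fun k hk => add_mem (h k hk) (h' k hk), ?_⟩
    convert add_mem hv hw using 1
    simp only [Pi.add_apply, single_add, Finset.sum_sub_distrib, Finset.sum_add_distrib]
    abel
  | neg v _ hv =>
    obtain ⟨c, d, h, hv⟩ := hv
    refine ⟨-c, -d, fun k hk => neg_mem (h k hk), ?_⟩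
    convert neg_mem hv using 1
    simp only [Pi.neg_apply, single_neg, Finset.sum_sub_distrib, Finset.sum_neg_distrib]
    abel

theorem mem_relations_of_mem_relations_insert [DecidableEq I] {n : I} {S : Finset I} (hn : n ∉ S)
    (hA : ∀ (T : Finset I) (m : I), n ∉ T → m ∉ T → n ≠ m → SumsDecompose A T)
    {v : I →₀ A} (hv : v ∈ R.relations ↑(insert n S)) (hvn : v n = 0) :
    v ∈ R.relations S := by
  obtain ⟨c, d, hcd, h⟩ := exists_sub_sum_mem_relations hv
  have hzero : ∀ w ∈ R.relations (S : Set I), w n = 0 := by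
    intro w hw
    induction hw using AddSubgroup.closure_induction with
    | mem w hw =>
      obtain ⟨i, hi, j, hj, a, b, -, rfl⟩ := hw
      have hin : i ≠ n := ne_of_mem_of_not_mem hi hn
      have hjn : j ≠ n := ne_of_mem_of_not_mem hj hn
      simp [hin, hjn]
    | zero => rfl
    | add v w _ _ hv hw => simp [hv, hw]
    | neg v _ hv => simp [hv]
  -- Read off the coordinate at `n`, where `v` and all relations over `S` vanish.
  have hc : ∑ i ∈ S, c i = 0 := by
    have h₀ := hzero _ h
    have h₁ : ∑ i ∈ S, (single i (d i)) n = 0 := Finset.sum_eq_zero fun i hi => by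
      simp [ne_of_mem_of_not_mem hi hn]
    simpa [hvn, finsetSum_apply, h₁] using h₀
  have hd := sum_single_mem_relations hn hA hcd hc
  convert sub_mem h hd using 1
  rw [Finset.sum_sub_distrib, ← single_finsetSum, hc, single_zero]
  abel

theorem exists_of_mem_relations_pair {x y : I} {v : I →₀ A} (hv : v ∈ R.relations {x, y}) :
    ∃ c d, (c, d) ∈ R.rel x y ∧ v = single x c - single y d := by
  induction hv using AddSubgroup.closure_induction with
  | mem v hv =>
    obtain ⟨i, hi, j, hj, a, b, hab, rfl⟩ := hv
    have h₀ := zero_mem (R.rel x y)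
    rcases hi with rfl | rfl <;> rcases hj with rfl | rfl
    · exact ⟨0, 0, h₀, by simp [(R.rel_self_iff _ _ _).1 hab]⟩
    · exact ⟨a, b, hab, rfl⟩
    · refine ⟨-b, -a, neg_mem (R.symm _ _ _ _ hab), ?_⟩
      simp only [single_neg]
      abel
    · exact ⟨0, 0, h₀, by simp [(R.rel_self_iff _ _ _).1 hab]⟩
  | zero => exact ⟨0, 0, zero_mem (R.rel x y), by simp⟩
  | add v w _ _ hv hw =>
    obtain ⟨c, d, h, rfl⟩ := hv
    obtain ⟨c', d', h', rfl⟩ := hw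
    refine ⟨c + c', d + d', add_mem h h', ?_⟩
    simp only [single_add]
    abel
  | neg v _ hv =>
    obtain ⟨c, d, h, rfl⟩ := hv
    refine ⟨-c, -d, neg_mem h, ?_⟩
    simp only [single_neg]
    abel

/-- The amalgam embeds into `⨁ A` modulo the identifications. -/
theorem single_sub_single_mem_relations_iff
    (hA : ∀ (T : Finset I) (n m : I), n ∉ T → m ∉ T → n ≠ m → SumsDecompose A T)
    {x y : I} {a b : A} :
    single x a - single y b ∈ R.relations Set.univ ↔ (a, b) ∈ R.rel x y := by
  classical
  refine ⟨fun h => ?_, fun h => single_sub_single_mem (Set.mem_univ _) (Set.mem_univ _) h⟩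
  obtain ⟨S, hS⟩ := exists_finset_mem_relations h
  have hS' : single x a - single y b ∈ R.relations ↑(S ∪ {x, y}) :=
    relations_mono (Finset.coe_subset.2 Finset.subset_union_left) hS
  -- Indices outside `{x, y}` can be discarded in turn, because the element has zero coordinate
  -- there.
  have hpair : single x a - single y b ∈ R.relations {x, y} := by
    clear hS
    induction S using Finset.induction_on with
    | empty => simpa using hS'
    | insert n S _ ih =>
      apply ih
      rw [Finset.insert_union] at hS'
      by_cases hn : n ∈ S ∪ {x, y}
      · rwa [Finset.insert_eq_of_mem hn] at hS'
      · refine mem_relations_of_mem_relations_insert hn (fun T m => hA T n m) hS' ?_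
        simp only [Finset.mem_union, Finset.mem_insert, Finset.mem_singleton, not_or] at hn
        simp [Ne.symm hn.2.1, Ne.symm hn.2.2]
  obtain ⟨c, d, hcd, heq⟩ := exists_of_mem_relations_pair hpair
  by_cases hxy : x = y
  · subst hxy
    rw [R.rel_self_iff] at hcd ⊢
    rw [hcd, sub_self, ← single_sub, single_eq_zero, sub_eq_zero] at heq
    exact heq
  · have h₁ := DFunLike.congr_fun heq x
    have h₂ := DFunLike.congr_fun heq y
    simp only [coe_sub, Pi.sub_apply, single_apply, hxy, Ne.symm hxy, if_true, if_false,
      sub_zero, zero_sub, neg_inj] at h₁ h₂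
    rwa [h₁, h₂]

end AbelianAmalgam

/-! ### The globalization of a partial action on an abelian group. -/

namespace GroupPartialAction

open Finsupp

variable {G : Type u} {H : Type v} [Group G]

theorem exists_mem_act_iff {A : Type v} (θ : PartialAction G A) (x : G) (a : A) :
    (∃ b, b ∈ θ.act x a) ↔ a ∈ θ.dom x⁻¹ :=
  ⟨fun ⟨b, hb⟩ => ⟨b, θ.inv_act _ _ _ hb⟩,
    fun ⟨b, hb⟩ => ⟨b, by simpa using θ.inv_act _ _ _ hb⟩⟩

/-- The axiom `act_one` only fixes the value once it is defined; definedness holds because the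
domain of `x` is the subgroup `D_{x⁻¹}`. The next two lemmas use the same argument. -/
theorem one_mem_act_one [Group H] (θ : GroupPartialAction G H) (x : G) : 1 ∈ θ.act x 1 := by
  obtain ⟨S, hS⟩ := θ.dom_isSubgroup x⁻¹
  obtain ⟨b, hb⟩ := (exists_mem_act_iff θ.toPartialAction x 1).2 (hS ▸ S.one_mem)
  rwa [θ.act_one x b hb] at hb

theorem mul_mem_act_mul [Group H] (θ : GroupPartialAction G H) {x : G} {a b a' b' : H}
    (ha : a' ∈ θ.act x a) (hb : b' ∈ θ.act x b) : a' * b' ∈ θ.act x (a * b) := by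
  obtain ⟨S, hS⟩ := θ.dom_isSubgroup x⁻¹
  have h : a * b ∈ (S : Set H) := S.mul_mem
    (hS ▸ (exists_mem_act_iff θ.toPartialAction x a).1 ⟨a', ha⟩ : a ∈ (S : Set H))
    (hS ▸ (exists_mem_act_iff θ.toPartialAction x b).1 ⟨b', hb⟩ : b ∈ (S : Set H))
  rw [hS] at h
  obtain ⟨c, hc⟩ := (exists_mem_act_iff θ.toPartialAction x _).2 h
  rwa [θ.act_mul x a b a' b' c ha hb hc] at hc

theorem inv_mem_act_inv [Group H] (θ : GroupPartialAction G H) {x : G} {a a' : H}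
    (ha : a' ∈ θ.act x a) : a'⁻¹ ∈ θ.act x a⁻¹ := by
  obtain ⟨S, hS⟩ := θ.dom_isSubgroup x⁻¹
  have h : a⁻¹ ∈ (S : Set H) := S.inv_mem
    (hS ▸ (exists_mem_act_iff θ.toPartialAction x a).1 ⟨a', ha⟩ : a ∈ (S : Set H))
  rw [hS] at h
  obtain ⟨c, hc⟩ := (exists_mem_act_iff θ.toPartialAction x _).2 h
  rwa [θ.act_inv x a a' c ha hc] at hc

/-- The amalgam of the copies `x H`, `x : G`, where `x a` is identified with `y b` if
`(y⁻¹ x) a = b`. -/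
def amalgam [CommGroup H] (θ : GroupPartialAction G H) : AbelianAmalgam G (Additive H) where
  rel x y :=
    { carrier := {p | p.2.toMul ∈ θ.act (y⁻¹ * x) p.1.toMul}
      zero_mem' := θ.one_mem_act_one _
      add_mem' := fun ha hb => θ.mul_mem_act_mul ha hb
      neg_mem' := fun ha => θ.inv_mem_act_inv ha }
  rel_self_iff x a b := by
    change b.toMul ∈ θ.act (x⁻¹ * x) a.toMul ↔ a = b
    rw [inv_mul_cancel]
    refine ⟨fun h => Part.mem_unique (θ.one_act a.toMul) h, ?_⟩
    rintro rfl
    exact θ.one_act _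
  symm x y a b h := by
    have := θ.inv_act _ _ _ h
    rwa [mul_inv_rev, inv_inv] at this
  trans x y z a b c hab hbc := by
    have := θ.mul_act _ _ _ _ _ hab hbc
    rwa [mul_assoc, mul_inv_cancel_left] at this

theorem mem_rel_amalgam [CommGroup H] (θ : GroupPartialAction G H) {x y : G} {a b : Additive H} :
    (a, b) ∈ θ.amalgam.rel x y ↔ b.toMul ∈ θ.act (y⁻¹ * x) a.toMul :=
  Iff.rfl

theorem relations_le_comap [CommGroup H] (θ : GroupPartialAction G H) (z : G) :
    θ.amalgam.relations Set.univ ≤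
      (θ.amalgam.relations Set.univ).comap (mapDomain.addMonoidHom (z * ·)) := by
  refine (AddSubgroup.closure_le _).2 ?_
  rintro _ ⟨x, -, y, -, a, b, hab, rfl⟩
  simp only [AddSubgroup.coe_comap, Set.mem_preimage, map_sub, mapDomain.addMonoidHom_apply,
    mapDomain_single]
  refine AbelianAmalgam.single_sub_single_mem (Set.mem_univ _) (Set.mem_univ _) ?_
  rw [mem_rel_amalgam] at hab ⊢
  rwa [mul_inv_rev, mul_assoc, inv_mul_cancel_left]

/-- The direct sum of the copies `x H`, `x : G`, modulo the identifications of the amalgam. -/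
abbrev Globalization [CommGroup H] (θ : GroupPartialAction G H) : Type (max u v) :=
  Multiplicative ((G →₀ Additive H) ⧸ θ.amalgam.relations Set.univ)

/-- Left translation by an element of `G`. -/
noncomputable def translate [CommGroup H] (θ : GroupPartialAction G H) (z : G) :
    ((G →₀ Additive H) ⧸ θ.amalgam.relations Set.univ) →+
      ((G →₀ Additive H) ⧸ θ.amalgam.relations Set.univ) :=
  QuotientAddGroup.map _ _ (mapDomain.addMonoidHom (z * ·)) (θ.relations_le_comap z)

theorem translate_mk [CommGroup H] (θ : GroupPartialAction G H) (z : G) (v : G →₀ Additive H) :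
    θ.translate z (QuotientAddGroup.mk v) = QuotientAddGroup.mk (mapDomain (z * ·) v) :=
  rfl

/-- `G` acts on the globalization by left translation. -/
noncomputable instance [CommGroup H] (θ : GroupPartialAction G H) : MulDistribMulAction G θ.Globalization where
  smul z b := Multiplicative.ofAdd (θ.translate z b.toAdd)
  one_smul b := by
    refine QuotientAddGroup.induction_on (C := fun b => θ.translate 1 b = b) b.toAdd fun v => ?_
    simp only [translate_mk, one_mul]
    exact congrArg _ mapDomain_id
  mul_smul x y b := by
    refine QuotientAddGroup.induction_on
      (C := fun b => θ.translate (x * y) b = θ.translate x (θ.translate y b)) b.toAdd fun v => ?_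
    simp only [translate_mk, ← mapDomain_comp]
    congr 2
    funext z
    exact mul_assoc x y z
  smul_mul z b c := map_add (θ.translate z) b.toAdd c.toAdd
  smul_one z := map_zero (θ.translate z)

/-- The canonical map from `H` to the globalization. -/
noncomputable def toGlobalization [CommGroup H] (θ : GroupPartialAction G H) : H →* θ.Globalization :=
  AddMonoidHom.toMultiplicativeRight
    ((QuotientAddGroup.mk' (θ.amalgam.relations Set.univ)).comp (singleAddHom 1))

/-- The left side says that `a` in copy `x` and `b` in copy `1` become equal in the quotient, so the
embedding of the amalgam applies. Taking `x = 1` gives injectivity. -/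
theorem smul_toGlobalization_eq_iff [CommGroup H] (θ : GroupPartialAction G H)
    (hH : ∀ (T : Finset G) (n m : G), n ∉ T → m ∉ T → n ≠ m → SumsDecompose (Additive H) T)
    (x : G) (a b : H) :
    x • θ.toGlobalization a = θ.toGlobalization b ↔ b ∈ θ.act x a := by
  have h₁ : x • θ.toGlobalization a = Multiplicative.ofAdd
      (QuotientAddGroup.mk (single x (Additive.ofMul a))) := by
    change Multiplicative.ofAdd (QuotientAddGroup.mk
      (mapDomain (x * ·) (single 1 (Additive.ofMul a)))) = _
    rw [mapDomain_single, mul_one]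
  have h₂ : θ.toGlobalization b = Multiplicative.ofAdd
      (QuotientAddGroup.mk (single 1 (Additive.ofMul b))) := rfl
  rw [h₁, h₂, Multiplicative.ofAdd.injective.eq_iff, eq_comm, QuotientAddGroup.eq,
    neg_add_eq_sub, AbelianAmalgam.single_sub_single_mem_relations_iff hH, mem_rel_amalgam,
    inv_one, one_mul]
  rfl

theorem hasGlobalization_of_sumsDecompose [CommGroup H] (θ : GroupPartialAction G H)
    (hH : ∀ (T : Finset G) (n m : G), n ∉ T → m ∉ T → n ≠ m → SumsDecompose (Additive H) T) :
    θ.HasGlobalization := by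
  have key := θ.smul_toGlobalization_eq_iff hH
  refine ⟨θ.Globalization, inferInstance, inferInstance, θ.toGlobalization, ?_, ?_, ?_⟩
  · intro a b hab
    rw [← one_smul G (θ.toGlobalization a), key] at hab
    exact Part.mem_unique (θ.one_act a) hab
  · exact fun x a b => (key x a b).2
  · intro x a
    rw [Part.dom_iff_mem]
    exact exists_congr fun b => by rw [← key, eq_comm]

end GroupPartialAction

/-! ### The two sufficient conditions. -/

theorem IsLocallyCyclicGroup.exists_zpow {H : Type v} [Group H] (hH : IsLocallyCyclicGroup H)
    (a b : H) : ∃ (t : H) (m n : ℤ), t ^ m = a ∧ t ^ n = b := by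
  obtain ⟨t, ht⟩ := hH (Subgroup.closure {a, b})
    ((Subgroup.fg_iff _).2 ⟨{a, b}, rfl, Set.toFinite _⟩)
  obtain ⟨m, hm⟩ := ht ⟨a, Subgroup.subset_closure (by simp)⟩
  obtain ⟨n, hn⟩ := ht ⟨b, Subgroup.subset_closure (by simp)⟩
  exact ⟨t, m, n, by simpa using congrArg Subtype.val hm, by simpa using congrArg Subtype.val hn⟩

theorem mainTheorem11 {G : Type u} {H : Type v} [Group G] [Group H]
    (θ : GroupPartialAction G H) :
    (IsLocallyCyclicGroup H → θ.HasGlobalization) ∧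
      (Nat.card G = 3 → (∀ a b : H, a * b = b * a) → θ.HasGlobalization) := by
  classical
  constructor
  · intro hH
    let _ : CommGroup H := { ‹Group H› with
      mul_comm := fun a b => by
        obtain ⟨t, m, n, rfl, rfl⟩ := hH.exists_zpow a b
        exact zpow_mul_comm t m n }
    refine GroupPartialAction.hasGlobalization_of_sumsDecompose (H := H) θ fun T _ _ _ _ _ =>
      sumsDecompose_of_exists_zsmul (fun a b => ?_) T
    obtain ⟨t, m, n, hm, hn⟩ := hH.exists_zpow a.toMul b.toMul
    exact ⟨Additive.ofMul t, m, n, hm.symm, hn.symm⟩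
  · intro hG hcomm
    let _ : CommGroup H := { ‹Group H› with mul_comm := hcomm }
    -- Only sums over sets `T` missing two distinct elements of `G` matter; when `G` has three
    -- elements, such a sum has at most one term.
    refine GroupPartialAction.hasGlobalization_of_sumsDecompose (H := H) θ fun T n m hn hm hnm =>
      sumsDecompose_of_card_le_one ?_
    have : Finite G := Nat.finite_of_card_ne_zero (by omega)
    have : Fintype G := Fintype.ofFinite G
    have hle := Finset.card_le_univ (insert n (insert m T))
    rw [Finset.card_insert_of_notMem (by simp [hnm, hn]), Finset.card_insert_of_notMem hm,
      ← Nat.card_eq_fintype_card, hG] at hle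
    omega
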